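/- \textbf{Setting.} A graph on $N$ nodes is given by a graph shift operator (GSO) $S\in\mathbb{R}^{N\times N}$. An $L$-layer GNN $\Phi$ with $K$ taps and pointwise nonlinearity $\sigma:\mathbb{R}\to\mathbb{R}$ sends an input signal $q\in\mathbb{R}^N$ to $X^{(L)}$, where $X^{(0)}=q$ (one feature) and $$X^{(l)}=\sigma\Big(\sum_{k=0}^{K-1}S^kX^{(l-1)}H^{(l)}_k\Big),\qquad H^{(l)}_k\in\mathbb{R}^{F_{l-1}\times F_l},\quad F_0=1 ;$$ write $\Phi(S,q)[:,f]$ for the $f$-th column of $X^{(L)}$. The filter of layer $l$ from feature $i$ to feature $j$ has taps $h_k=H^{(l)}_k[i,j]$, operator $H(S)=\sum_k h_kS^k$ and frequency response $h(\lambda)=\sum_k h_k\lambda^k$. All norms are Euclidean norms of vectors and the induced operator norms of matrices. For operators $A,B$ taking $M$ signals to one signal put $$\|A-B\|_{\mathcal P}=\min_{\Pi}\ \max_{\|q^{(1)}\|=\dots=\|q^{(M)}\|=1}\big\|\Pi^TA(q^{(1)},\dots,q^{(M)})-B(\Pi^Tq^{(1)},\dots,\Pi^Tq^{(M)})\big\|,$$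 $\Pi$ ranging over the permutation matrices, and $\|a-b\|_{\mathcal P}=\min_\Pi\|\Pi^Ta-b\|$ for vectors $a,b$. The R-PEARL encoding of $q^{(1)},\dots,q^{(M)}$ is $P_S=\frac1M\sum_{m=1}^M\Phi(S,q^{(m)})$, and the B-PEARL encoding is $P^B_S=\sum_{m=1}^N\Phi(S,e_m)$, with $e_m$ the standard basis vectors. \textbf{Corollary (Stability).} Let $N,L\ge 0$, $F\ge1$ and $C\ge 0$. There is a function $r:\mathbb{R}\to\mathbb{R}$ with $r(\varepsilon)=\mathcal{O}(\varepsilon^2)$ as $\varepsilon\to0$, depending only on $N,L,F,C$ (in particular independent of the eigenvalues and eigengaps of the GSO, and of $M$ and $K$), such that the following holds. Let $\tilde S=S+E$ with $\|E\|\le\varepsilon$. Let $\Phi$ be an $L$-layer GNN with at most $F$ features in each hidden layer such that $|\sigma(a)-\sigma(b)|\le|a-b|$ for all $a,b$, $\sigma(0)=0$, every filter satisfies $\|H(S)\|\le 1/F$, and every filter is Lipschitz with constant $C$: $|h(\lambda_2)-h(\lambda_1)|\le C|\lambda_2-\lambda_1|$ for all $\lambda_1,\lambda_2\in I$, where either $I=\mathbb{R}$,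 or $S$ and $E$ are symmetric and $I\subseteq\mathbb{R}$ contains the spectra of $S$ and $\tilde S$. Then, for every output feature $f$ and every number $M$ of samples, $$\Big\|\frac1M\sum_{m=1}^M\Phi(S,\cdot)[:,f]-\frac1M\sum_{m=1}^M\Phi(\tilde S,\cdot)[:,f]\Big\|_{\mathcal P}\le C\,(1+8\sqrt N)\,L\,\varepsilon+r(\varepsilon),$$ both with $M$ separate inputs (that is, for the R-PEARL encodings $P_S[:,f]$ and $P_{\tilde S}[:,f]$ as operators of $(q^{(1)},\dots,q^{(M)})$) and with a single input common to all summands. The B-PEARL encodings, averaged over their $M=N$ inputs, satisfy the same bound: $\big\|\frac1N P^B_S[:,f]-\frac1N P^B_{\tilde S}[:,f]\big\|_{\mathcal P}\le C\,(1+8\sqrt N)\,L\,\varepsilon+r(\varepsilon)$. -/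

import Mathlib

open scoped ENNReal

noncomputable section

namespace Pearl

/-- Graph signals on `N` nodes, with the Euclidean norm. -/
abbrev Signal (N : ℕ) : Type := EuclideanSpace ℝ (Fin N)

/-- The spectral (`ℓ²` operator) norm of a square real matrix. -/
def opNorm {N : ℕ} (A : Matrix (Fin N) (Fin N) ℝ) : ℝ :=
  ‖Matrix.toEuclideanCLM (n := Fin N) (𝕜 := ℝ) A‖

/-- The graph filter `H(S) = ∑ₖ hₖ Sᵏ` with taps `h₀, …, h_{K-1}`. -/
def graphFilter {N K : ℕ} (h : Fin K → ℝ) (S : Matrix (Fin N) (Fin N) ℝ) :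
    Matrix (Fin N) (Fin N) ℝ :=
  ∑ k : Fin K, h k • S ^ (k : ℕ)

/-- The frequency response `h(x) = ∑ₖ hₖ xᵏ` of a filter. -/
def freqResponse {K : ℕ} (h : Fin K → ℝ) (x : ℝ) : ℝ :=
  ∑ k : Fin K, h k * x ^ (k : ℕ)

/-- The filter is Lipschitz with constant `C` on a set `I` of frequencies
(`I = Set.univ`: Lipschitz on the whole line). -/
def IsLipschitzFilterOn {K : ℕ} (C : ℝ) (I : Set ℝ) (h : Fin K → ℝ) : Prop :=
  ∀ x ∈ I, ∀ y ∈ I, |freqResponse h y - freqResponse h x| ≤ C * |y - x|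

/-- The data of a graph neural network with `K` taps per filter.  Layer `l + 1` maps `width l`
features to `width (l + 1)` features; the input has a single feature.  The number of layers in
use is a separate argument of `GNN.features`. -/
structure GNN (K : ℕ) where
  /-- number of features at each level -/
  width : ℕ → ℕ
  /-- the input signal has one feature -/
  width_zero : width 0 = 1
  /-- the coefficient matrices `H_k` of layer `l + 1` -/
  weight : (l : ℕ) → Fin K → Matrix (Fin (width l)) (Fin (width (l + 1))) ℝ
  /-- the pointwise nonlinearity -/
  act : ℝ → ℝ

/-- The taps of the filter of layer `l + 1` from input feature `i` to output feature `j`. -/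
def GNN.taps {K : ℕ} (Φ : GNN K) (l : ℕ) (i : Fin (Φ.width l)) (j : Fin (Φ.width (l + 1))) :
    Fin K → ℝ :=
  fun k => Φ.weight l k i j

/-- The features after `l` layers, on the graph with shift operator `S` and input signal `q`:
`X⁽⁰⁾ = q` and `X⁽ˡ⁺¹⁾ = σ(∑ₖ Sᵏ X⁽ˡ⁾ Hₖ)`. -/
def GNN.features {N K : ℕ} (Φ : GNN K) (S : Matrix (Fin N) (Fin N) ℝ) (q : Signal N) :
    (l : ℕ) → Matrix (Fin N) (Fin (Φ.width l)) ℝ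
  | 0 => Matrix.of fun v _ => q v
  | l + 1 => (∑ k : Fin K, S ^ (k : ℕ) * GNN.features Φ S q l * Φ.weight l k).map Φ.act

/-- The feature `Φ(S, q)[:, f]` of the output of the `L`-layer network. -/
def GNN.output {N K : ℕ} (Φ : GNN K) (L : ℕ) (f : Fin (Φ.width L))
    (S : Matrix (Fin N) (Fin N) ℝ) (q : Signal N) : Signal N :=
  WithLp.toLp 2 fun v => Φ.features S q L v f

/-- Feature `f` of the R-PEARL encoding: the mean of the outputs on the samples `q⁽¹⁾, …, q⁽ᴹ⁾`. -/
def rPearl {N K M : ℕ} (Φ : GNN K) (L : ℕ) (f : Fin (Φ.width L))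
    (S : Matrix (Fin N) (Fin N) ℝ) (q : Fin M → Signal N) : Signal N :=
  (1 / (M : ℝ)) • ∑ m : Fin M, Φ.output L f S (q m)

/-- Feature `f` of the B-PEARL encoding: the sum of the outputs on the standard basis vectors. -/
def bPearl {N K : ℕ} (Φ : GNN K) (L : ℕ) (f : Fin (Φ.width L))
    (S : Matrix (Fin N) (Fin N) ℝ) : Signal N :=
  ∑ m : Fin N, Φ.output L f S (EuclideanSpace.single m (1 : ℝ))

/-- The action `x ↦ Πᵀ x` of a permutation matrix on signals. -/
def permute {N : ℕ} (π : Equiv.Perm (Fin N)) (x : Signal N) : Signal N :=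
  WithLp.toLp 2 fun v => x (π v)

/-- Operator distance modulo permutation,
`min_Π max_{‖x‖ = 1} ‖Πᵀ (A x) - B (Πᵀ x)‖`, with values in `[0, ∞]`. -/
def opDist {N : ℕ} (A B : Signal N → Signal N) : ℝ≥0∞ :=
  ⨅ π : Equiv.Perm (Fin N), ⨆ (x : Signal N) (_ : ‖x‖ = 1),
    ‖permute π (A x) - B (permute π x)‖ₑ

/-- The same distance for operators with `M` input signals; all inputs have norm one and are
permuted by the same `Π`. -/
def opDistMulti {N M : ℕ} (A B : (Fin M → Signal N) → Signal N) : ℝ≥0∞ :=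
  ⨅ π : Equiv.Perm (Fin N), ⨆ (q : Fin M → Signal N) (_ : ∀ m, ‖q m‖ = 1),
    ‖permute π (A q) - B (fun m => permute π (q m))‖ₑ

/-- Distance modulo permutation of two signals, `min_Π ‖Πᵀ a - b‖`. -/
def signalDist {N : ℕ} (a b : Signal N) : ℝ≥0∞ :=
  ⨅ π : Equiv.Perm (Fin N), ‖permute π a - b‖ₑ

end Pearl

end

/-!
The identity permutation suffices, so everything rests on comparing the two networks on the same
input. Let `T = S + E`.

A polynomial which is Lipschitz on the whole line is affine, so in that case `h(S) - h(T)` is a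
multiple of `E`, of norm at most `C ‖E‖`. In the symmetric case, let `v` be an eigenvector of `S`
with eigenvalue `μ` and expand it in an orthonormal eigenbasis `u i` of `T` with eigenvalues `a i`:
the coordinates of `(h(S) - h(T)) v` and of `(S - T) v` are `(h(μ) - h(a i)) ⟪u i, v⟫` and
`(μ - a i) ⟪u i, v⟫`, so the Lipschitz condition at pairs of eigenvalues is all that is needed, and
no eigengap enters. Passing from the eigenvectors of `S` to arbitrary vectors costs a factor `√N`
by Cauchy-Schwarz.

If all filters move by at most `δ`, the error after `l` layers, relative to the norm of the input,
satisfies `d (l + 1) ≤ (1 + F δ) d l + δ`. The solution of this recursion is a polynomial in `δ`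
with linear part `l δ`.
-/

namespace Pearl

open Bornology Filter InnerProductSpace NNReal Polynomial
open Matrix (isHermitian_iff_isSymm toEuclideanCLM)

section LipschitzPolynomial

variable {𝕜 : Type*} [NontriviallyNormedField 𝕜] {p : 𝕜[X]}

theorem degree_le_zero_of_eventually_norm_eval_le {K : ℝ}
    (hp : ∀ᶠ x in cobounded 𝕜, ‖p.eval x‖ ≤ K) : p.degree ≤ 0 := by
  by_contra! hdeg
  have hunbounded := p.tendsto_norm_atTop hdeg tendsto_norm_cobounded_atTop
  obtain ⟨x, hle, hlt⟩ := (hp.and (hunbounded.eventually_gt_atTop K)).exists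
  exact hlt.not_ge hle

theorem exists_eq_C_mul_X_add_C_of_lipschitzWith {K : ℝ≥0} (hp : LipschitzWith K p.eval) :
    ∃ a b, ‖a‖ ≤ K ∧ p = C a * X + C b := by
  have hquot : ∀ x ≠ 0, ‖p.divX.eval x‖ ≤ K := by
    intro x hx
    have hsub : p.eval x - p.eval 0 = p.divX.eval x * x := by
      nth_rw 1 [← divX_mul_X_add p]
      simp [coeff_zero_eq_eval_zero]
    have hle := hp.norm_sub_le x 0
    rw [hsub, norm_mul, sub_zero] at hle
    exact le_of_mul_le_mul_right hle (norm_pos_iff.2 hx)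
  obtain ⟨a, ha⟩ : ∃ a, p.divX = C a :=
    ⟨_, eq_C_of_degree_le_zero <| degree_le_zero_of_eventually_norm_eval_le <|
      (eventually_ne_cobounded 0).mono hquot⟩
  refine ⟨a, p.coeff 0, by simpa [ha] using hquot 1 one_ne_zero, ?_⟩
  rw [← ha, divX_mul_X_add]

theorem lipschitzWith_aeval {K : ℝ≥0} (hp : LipschitzWith K p.eval) (R : Type*)
    [SeminormedRing R] [NormedAlgebra 𝕜 R] : LipschitzWith K fun x : R => aeval x p := by
  obtain ⟨a, b, ha, rfl⟩ := exists_eq_C_mul_X_add_C_of_lipschitzWith hp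
  refine LipschitzWith.of_dist_le_mul fun x y => ?_
  simp only [map_add, map_mul, aeval_C, aeval_X, dist_add_right, ← Algebra.smul_def, dist_smul₀]
  gcongr

end LipschitzPolynomial

section OrthonormalEigenbasis

variable {𝕜 E G ι : Type*} [RCLike 𝕜] [NormedAddCommGroup E] [InnerProductSpace 𝕜 E]
  [NormedAddCommGroup G] [NormedSpace 𝕜 G] [Fintype ι]

theorem aeval_apply_of_apply_eq_smul {A : E →L[𝕜] E} {x : E} {a : 𝕜} (hA : A x = a • x)
    (p : 𝕜[X]) : aeval A p x = p.eval a • x := by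
  have : IsScalarTower 𝕜 (E →L[𝕜] E) E := ⟨fun _ _ _ => rfl⟩
  have hlsmul : Algebra.lsmul 𝕜 𝕜 E A x = a • x := hA
  rw [← Module.End.aeval_apply_of_mem_apply_eq_smul hlsmul, aeval_algHom_apply]
  rfl

theorem inner_apply_of_apply_eq_smul {A : E →L[𝕜] E} (u : OrthonormalBasis ι 𝕜 E) {a : ι → 𝕜}
    (hA : ∀ i, A (u i) = a i • u i) (x : E) (i : ι) : ⟪u i, A x⟫_𝕜 = a i * ⟪u i, x⟫_𝕜 := by
  classical
  conv_lhs => rw [← u.sum_repr' x]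
  simp [hA, inner_sum, inner_smul_right, u.inner_eq_ite, mul_comm]

theorem norm_aeval_sub_aeval_apply_le {p : 𝕜[X]} {K : ℝ≥0} {I : Set 𝕜}
    (hp : LipschitzOnWith K p.eval I) {A B : E →L[𝕜] E} (u : OrthonormalBasis ι 𝕜 E) {a : ι → 𝕜}
    (hA : ∀ i, A (u i) = a i • u i) (ha : ∀ i, a i ∈ I) {x : E} {b : 𝕜} (hB : B x = b • x)
    (hb : b ∈ I) : ‖(aeval B p - aeval A p) x‖ ≤ K * ‖(B - A) x‖ := by
  have hcoord : ∀ i, ⟪u i, (B - A) x⟫_𝕜 = (b - a i) * ⟪u i, x⟫_𝕜 := by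
    intro i
    rw [sub_apply, inner_sub_right, hB, inner_smul_right, inner_apply_of_apply_eq_smul u hA,
      sub_mul]
  have hcoord_aeval : ∀ i,
      ⟪u i, (aeval B p - aeval A p) x⟫_𝕜 = (p.eval b - p.eval (a i)) * ⟪u i, x⟫_𝕜 := by
    intro i
    rw [sub_apply, inner_sub_right, aeval_apply_of_apply_eq_smul hB, inner_smul_right,
      inner_apply_of_apply_eq_smul u (fun i => aeval_apply_of_apply_eq_smul (hA i) p), sub_mul]
  refine le_of_sq_le_sq ?_ (by positivity)
  rw [mul_pow, ← u.sum_sq_norm_inner_right, ← u.sum_sq_norm_inner_right, Finset.mul_sum]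
  gcongr with i
  rw [hcoord, hcoord_aeval, ← mul_pow, norm_mul, norm_mul, ← mul_assoc]
  gcongr
  exact hp.norm_sub_le hb (ha i)

theorem opNorm_le_sqrt_card_mul (u : OrthonormalBasis ι 𝕜 E) {D : E →L[𝕜] G} {δ : ℝ} (hδ : 0 ≤ δ)
    (hD : ∀ i, ‖D (u i)‖ ≤ δ) : ‖D‖ ≤ √(Fintype.card ι) * δ := by
  refine D.opNorm_le_bound (by positivity) fun x => ?_
  have hcauchy : ∑ i, ‖⟪u i, x⟫_𝕜‖ ≤ √(Fintype.card ι) * ‖x‖ := by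
    refine le_of_sq_le_sq ?_ (by positivity)
    rw [mul_pow, Real.sq_sqrt (Nat.cast_nonneg _), ← u.sum_sq_norm_inner_right x]
    exact sq_sum_le_card_mul_sum_sq
  calc ‖D x‖ = ‖∑ i, ⟪u i, x⟫_𝕜 • D (u i)‖ := by
        conv_lhs => rw [← u.sum_repr' x, map_sum]
        simp only [map_smul]
    _ ≤ ∑ i, ‖⟪u i, x⟫_𝕜‖ * δ := norm_sum_le_of_le _ fun i _ => by
        rw [norm_smul]
        gcongr
        exact hD i
    _ = (∑ i, ‖⟪u i, x⟫_𝕜‖) * δ := by rw [Finset.sum_mul]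
    _ ≤ √(Fintype.card ι) * ‖x‖ * δ := by gcongr
    _ = √(Fintype.card ι) * δ * ‖x‖ := by ring

theorem norm_aeval_sub_aeval_le_sqrt_card_mul {κ : Type*} [Fintype κ] {p : 𝕜[X]} {K : ℝ≥0}
    {I : Set 𝕜} (hp : LipschitzOnWith K p.eval I) {A B : E →L[𝕜] E}
    (u : OrthonormalBasis ι 𝕜 E) {a : ι → 𝕜} (hA : ∀ i, A (u i) = a i • u i) (ha : ∀ i, a i ∈ I)
    (v : OrthonormalBasis κ 𝕜 E) {b : κ → 𝕜} (hB : ∀ j, B (v j) = b j • v j)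
    (hb : ∀ j, b j ∈ I) :
    ‖aeval B p - aeval A p‖ ≤ √(Fintype.card κ) * (K * ‖B - A‖) := by
  refine opNorm_le_sqrt_card_mul v (by positivity) fun j => ?_
  calc ‖(aeval B p - aeval A p) (v j)‖ ≤ K * ‖(B - A) (v j)‖ :=
        norm_aeval_sub_aeval_apply_le hp u hA ha (hB j) (hb j)
    _ ≤ K * ‖B - A‖ := by
        gcongr
        exact (B - A).unit_le_opNorm _ (v.norm_eq_one j).le

end OrthonormalEigenbasis

section Filters

/-- The polynomial `∑ₖ hₖ Xᵏ` of a filter: its evaluation is the frequency response, and its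
evaluation at a graph shift operator is the graph filter. -/
noncomputable def filterPoly {K : ℕ} (h : Fin K → ℝ) : ℝ[X] :=
  ∑ k : Fin K, C (h k) * X ^ (k : ℕ)

theorem eval_filterPoly {K : ℕ} (h : Fin K → ℝ) (x : ℝ) :
    (filterPoly h).eval x = freqResponse h x := by
  simp [filterPoly, freqResponse, eval_finsetSum]

theorem aeval_filterPoly {N K : ℕ} (h : Fin K → ℝ) (S : Matrix (Fin N) (Fin N) ℝ) :
    aeval S (filterPoly h) = graphFilter h S := by
  simp [filterPoly, graphFilter, Algebra.smul_def]

theorem isLipschitzFilterOn_iff_lipschitzOnWith {K : ℕ} {C : ℝ≥0} {I : Set ℝ} {h : Fin K → ℝ} :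
    IsLipschitzFilterOn C I h ↔ LipschitzOnWith C (filterPoly h).eval I := by
  simp only [IsLipschitzFilterOn, lipschitzOnWith_iff_norm_sub_le, eval_filterPoly,
    Real.norm_eq_abs]
  exact ⟨fun hh x hx y hy => hh y hy x hx, fun hh x hx y hy => hh hy hx⟩

/-- The graph filter `H(S)` as a continuous operator on signals, so that `opNorm (H(S))` is its
operator norm. -/
noncomputable def filterOp {N K : ℕ} (h : Fin K → ℝ) (S : Matrix (Fin N) (Fin N) ℝ) :
    Signal N →L[ℝ] Signal N :=
  toEuclideanCLM (𝕜 := ℝ) (graphFilter h S)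

theorem filterOp_eq_aeval {N K : ℕ} (h : Fin K → ℝ) (S : Matrix (Fin N) (Fin N) ℝ) :
    filterOp h S = aeval (toEuclideanCLM (𝕜 := ℝ) S) (filterPoly h) := by
  rw [filterOp, ← aeval_filterPoly, aeval_algHom_apply]

theorem toEuclideanCLM_eigenvectorBasis {N : ℕ} {S : Matrix (Fin N) (Fin N) ℝ}
    (hS : S.IsHermitian) (i : Fin N) :
    toEuclideanCLM (𝕜 := ℝ) S (hS.eigenvectorBasis i) =
      hS.eigenvalues i • hS.eigenvectorBasis i :=
  PiLp.ext fun v => congrFun (hS.mulVec_eigenvectorBasis i) v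

variable {N K : ℕ} {C : ℝ} {I : Set ℝ} {h : Fin K → ℝ} {S T : Matrix (Fin N) (Fin N) ℝ}

theorem norm_filterOp_sub_le_of_univ (hC : 0 ≤ C) (hh : IsLipschitzFilterOn C Set.univ h) :
    ‖filterOp h S - filterOp h T‖ ≤ C * opNorm (S - T) := by
  lift C to ℝ≥0 using hC
  have hpoly := lipschitzOnWith_univ.1 (isLipschitzFilterOn_iff_lipschitzOnWith.1 hh)
  simpa only [filterOp_eq_aeval, opNorm, map_sub] using
    (lipschitzWith_aeval hpoly (Signal N →L[ℝ] Signal N)).norm_sub_le _ _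

theorem norm_filterOp_sub_le_of_isHermitian (hC : 0 ≤ C) (hh : IsLipschitzFilterOn C I h)
    (hS : S.IsHermitian) (hT : T.IsHermitian) (hSI : spectrum ℝ S ⊆ I) (hTI : spectrum ℝ T ⊆ I) :
    ‖filterOp h S - filterOp h T‖ ≤ √N * (C * opNorm (S - T)) := by
  lift C to ℝ≥0 using hC
  simpa only [filterOp_eq_aeval, opNorm, map_sub, Fintype.card_fin] using
    norm_aeval_sub_aeval_le_sqrt_card_mul (isLipschitzFilterOn_iff_lipschitzOnWith.1 hh)
      hT.eigenvectorBasis (toEuclideanCLM_eigenvectorBasis hT)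
      (fun i => hTI (hT.eigenvalues_mem_spectrum_real i))
      hS.eigenvectorBasis (toEuclideanCLM_eigenvectorBasis hS)
      (fun i => hSI (hS.eigenvalues_mem_spectrum_real i))

theorem norm_filterOp_sub_filterOp_add_le {E : Matrix (Fin N) (Fin N) ℝ} (hC : 0 ≤ C)
    (hI : I = Set.univ ∨
      (S.IsSymm ∧ E.IsSymm ∧ spectrum ℝ S ⊆ I ∧ spectrum ℝ (S + E) ⊆ I))
    (hh : IsLipschitzFilterOn C I h) :
    ‖filterOp h S - filterOp h (S + E)‖ ≤ max 1 √N * (C * opNorm E) := by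
  have hE : 0 ≤ C * opNorm E := mul_nonneg hC (norm_nonneg _)
  rw [norm_sub_rev]
  rcases hI with rfl | ⟨hS, hE_symm, hSI, hTI⟩
  · calc ‖filterOp h (S + E) - filterOp h S‖ ≤ C * opNorm E := by
          simpa using norm_filterOp_sub_le_of_univ (S := S + E) (T := S) hC hh
      _ ≤ max 1 √N * (C * opNorm E) := le_mul_of_one_le_left hE (le_max_left _ _)
  · calc ‖filterOp h (S + E) - filterOp h S‖ ≤ √N * (C * opNorm E) := by
          simpa using norm_filterOp_sub_le_of_isHermitian hC hh
            (isHermitian_iff_isSymm.2 (hS.add hE_symm)) (isHermitian_iff_isSymm.2 hS) hTI hSI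
      _ ≤ max 1 √N * (C * opNorm E) := by gcongr; exact le_max_right _ _

theorem norm_filterOp_sub_filterOp_add_le_of_opNorm_le {E : Matrix (Fin N) (Fin N) ℝ} {ε : ℝ}
    (hC : 0 ≤ C)
    (hI : I = Set.univ ∨
      (S.IsSymm ∧ E.IsSymm ∧ spectrum ℝ S ⊆ I ∧ spectrum ℝ (S + E) ⊆ I))
    (hh : IsLipschitzFilterOn C I h) (hE : opNorm E ≤ ε) :
    ‖filterOp h S - filterOp h (S + E)‖ ≤ C * (1 + 8 * √N) * ε := by
  have hmax : max 1 √N ≤ 1 + 8 * √N := by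
    have hsqrt := Real.sqrt_nonneg (N : ℝ)
    exact max_le (by linarith) (by linarith)
  have hE_nonneg : 0 ≤ C * opNorm E := mul_nonneg hC (norm_nonneg _)
  calc ‖filterOp h S - filterOp h (S + E)‖ ≤ max 1 √N * (C * opNorm E) :=
        norm_filterOp_sub_filterOp_add_le hC hI hh
    _ ≤ (1 + 8 * √N) * (C * ε) := by gcongr
    _ = C * (1 + 8 * √N) * ε := by ring

end Filters

section Layers

/-- The entrywise application of a nonlinearity to a signal. -/
noncomputable def pointwise {ι : Type*} (σ : ℝ → ℝ) (x : EuclideanSpace ℝ ι) :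
    EuclideanSpace ℝ ι :=
  WithLp.toLp 2 fun v => σ (x v)

theorem lipschitzWith_pointwise {ι : Type*} [Fintype ι] {σ : ℝ → ℝ} {K : ℝ≥0}
    (hσ : LipschitzWith K σ) :
    LipschitzWith K (pointwise σ : EuclideanSpace ℝ ι → EuclideanSpace ℝ ι) := by
  refine LipschitzWith.of_dist_le_mul fun x y => le_of_sq_le_sq ?_ (by positivity)
  rw [mul_pow, EuclideanSpace.dist_sq_eq, EuclideanSpace.dist_sq_eq, Finset.mul_sum]
  gcongr with v
  rw [← mul_pow]
  gcongr
  exact hσ.dist_le_mul _ _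

theorem pointwise_zero {ι : Type*} {σ : ℝ → ℝ} (hσ : σ 0 = 0) :
    pointwise σ (0 : EuclideanSpace ℝ ι) = 0 :=
  PiLp.ext fun _ => hσ

theorem norm_sum_apply_sub_sum_apply_le {𝕜 E G ι : Type*} [NontriviallyNormedField 𝕜]
    [SeminormedAddCommGroup E] [NormedSpace 𝕜 E] [SeminormedAddCommGroup G] [NormedSpace 𝕜 G]
    [Fintype ι] {A B : ι → E →L[𝕜] G} {x y : ι → E} {α δ d : ℝ} (hA : ∀ i, ‖A i‖ ≤ α)
    (hAB : ∀ i, ‖A i - B i‖ ≤ δ) (hxy : ∀ i, ‖x i - y i‖ ≤ d) :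
    ‖∑ i, A i (x i) - ∑ i, B i (y i)‖ ≤ Fintype.card ι * ((α + δ) * d) + δ * ∑ i, ‖x i‖ := by
  have hterm : ∀ i, ‖A i (x i) - B i (y i)‖ ≤ (α + δ) * d + δ * ‖x i‖ := by
    intro i
    have hB : ‖B i‖ ≤ α + δ := by
      simpa using norm_sub_le_of_le (hA i) (hAB i)
    -- Only the inputs `x i`, not the `y i`, are to appear in the bound.
    have hsplit : A i (x i) - B i (y i) = B i (x i - y i) + (A i - B i) (x i) := by
      rw [map_sub, sub_apply]
      abel
    rw [hsplit]
    exact norm_add_le_of_le ((B i).le_of_opNorm_le_of_le hB (hxy i))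
      ((A i - B i).le_of_opNorm_le (hAB i) (x i))
  calc ‖∑ i, A i (x i) - ∑ i, B i (y i)‖ ≤ ∑ i, ((α + δ) * d + δ * ‖x i‖) := by
        rw [← Finset.sum_sub_distrib]
        exact norm_sum_le_of_le _ fun i _ => hterm i
    _ = Fintype.card ι * ((α + δ) * d) + δ * ∑ i, ‖x i‖ := by
        simp [Finset.sum_add_distrib, Finset.mul_sum]

variable {N K : ℕ} {Φ : GNN K} {F : ℝ} {S T : Matrix (Fin N) (Fin N) ℝ}

theorem width_le_of_forall_pos {L F : ℕ} (hF : 0 < F)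
    (hwidth : ∀ l, 0 < l → l < L → Φ.width l ≤ F) :
    ∀ l < L, (Φ.width l : ℝ) ≤ F := by
  intro l hl
  rcases l.eq_zero_or_pos with rfl | hpos
  · simpa [Φ.width_zero, Nat.one_le_iff_ne_zero] using hF.ne'
  · exact_mod_cast hwidth l hpos hl

theorem output_zero (i : Fin (Φ.width 0)) (q : Signal N) : Φ.output 0 i S q = q := rfl

theorem output_succ (l : ℕ) (j : Fin (Φ.width (l + 1))) (q : Signal N) :
    Φ.output (l + 1) j S q =
      pointwise Φ.act (∑ i, filterOp (Φ.taps l i j) S (Φ.output l i S q)) := by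
  ext v
  simp only [GNN.output, GNN.features, pointwise, filterOp, Matrix.map_apply, Matrix.sum_apply,
    Matrix.mul_apply, graphFilter, map_sum, map_smul, sum_apply, smul_apply,
    Matrix.toEuclideanCLM_toLp, WithLp.ofLp_sum, Finset.sum_apply, WithLp.ofLp_smul, Pi.smul_apply,
    smul_eq_mul, Matrix.mulVec, dotProduct, GNN.taps]
  rw [Finset.sum_comm]
  simp only [mul_comm]

theorem norm_output_succ_le {l : ℕ} {j : Fin (Φ.width (l + 1))} {α : ℝ}
    (hact : LipschitzWith 1 Φ.act) (hact0 : Φ.act 0 = 0)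
    (hbound : ∀ i, ‖filterOp (Φ.taps l i j) S‖ ≤ α) (q : Signal N) :
    ‖Φ.output (l + 1) j S q‖ ≤ α * ∑ i, ‖Φ.output l i S q‖ := by
  rw [output_succ, Finset.mul_sum]
  calc _ ≤ ‖∑ i, filterOp (Φ.taps l i j) S (Φ.output l i S q)‖ := by
        simpa using (lipschitzWith_pointwise (ι := Fin N) hact).norm_le_mul (pointwise_zero hact0) _
    _ ≤ ∑ i, α * ‖Φ.output l i S q‖ :=
        norm_sum_le_of_le _ fun i _ => ContinuousLinearMap.le_of_opNorm_le _ (hbound i) _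

theorem sum_norm_output_le {L : ℕ} (hwidth : ∀ l < L, (Φ.width (l + 1) : ℝ) ≤ F)
    (hact : LipschitzWith 1 Φ.act) (hact0 : Φ.act 0 = 0)
    (hbound : ∀ l < L, ∀ i j, ‖filterOp (Φ.taps l i j) S‖ ≤ 1 / F) (q : Signal N) :
    ∑ i, ‖Φ.output L i S q‖ ≤ ‖q‖ := by
  induction L with
  | zero => simp [output_zero, Φ.width_zero]
  | succ L ih =>
    have hF : 0 ≤ F := (Nat.cast_nonneg _).trans (hwidth L L.lt_succ_self)
    have hprev := ih (fun l hl => hwidth l (hl.trans L.lt_succ_self))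
      (fun l hl => hbound l (hl.trans L.lt_succ_self))
    calc ∑ j, ‖Φ.output (L + 1) j S q‖ ≤ ∑ _j : Fin (Φ.width (L + 1)), 1 / F * ‖q‖ := by
          gcongr with j
          exact (norm_output_succ_le hact hact0 (hbound L L.lt_succ_self · j) q).trans (by gcongr)
      _ = Φ.width (L + 1) / F * ‖q‖ := by
          simp only [Finset.sum_const, Finset.card_univ, Fintype.card_fin, nsmul_eq_mul]
          ring
      _ ≤ ‖q‖ := mul_le_of_le_one_left (norm_nonneg q)
          (div_le_one_of_le₀ (hwidth L L.lt_succ_self) hF)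

end Layers

section Stability

/-- The solution `δ ∑_{k < l} (1 + F δ)ᵏ` of the recursion `d₀ = 0`, `d_{l+1} = (1 + F δ) d_l + δ`.
It bounds the relative error of a feature after `l` layers of at most `F` features whose filters
have norm at most `1 / F` and are perturbed by at most `δ`. -/
noncomputable def layerError (F δ : ℝ) (l : ℕ) : ℝ :=
  δ * ∑ k ∈ Finset.range l, (1 + F * δ) ^ k

theorem layerError_zero (F δ : ℝ) : layerError F δ 0 = 0 := by simp [layerError]

theorem layerError_succ (F δ : ℝ) (l : ℕ) :
    layerError F δ (l + 1) = (1 + F * δ) * layerError F δ l + δ := by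
  rw [layerError, layerError, geom_sum_succ]
  ring

theorem layerError_nonneg {F δ : ℝ} (hF : 0 ≤ F) (hδ : 0 ≤ δ) (l : ℕ) :
    0 ≤ layerError F δ l := by
  unfold layerError
  positivity

theorem isBigO_layerError_sub_linear (F c : ℝ) (l : ℕ) :
    (fun ε => layerError F (c * ε) l - c * l * ε) =O[nhds 0] fun ε => ε ^ 2 := by
  let s : ℝ → ℝ := fun ε => ∑ k ∈ Finset.range l, (1 + F * (c * ε)) ^ k
  have hs : (fun ε => s ε - s 0) =O[nhds 0] fun ε : ℝ => ε := by
    have hdiff : DifferentiableAt ℝ s 0 := by fun_prop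
    simpa using hdiff.isBigO_sub
  refine (((Asymptotics.isBigO_refl (fun ε : ℝ => ε) _).const_mul_left c).mul hs).congr
    (fun ε => ?_) fun ε => (sq ε).symm
  simp only [s, layerError, mul_zero, add_zero, one_pow, Finset.sum_const, Finset.card_range,
    nsmul_eq_mul, mul_one]
  ring

theorem norm_output_sub_output_le {N K L : ℕ} {Φ : GNN K} {F δ : ℝ}
    {S T : Matrix (Fin N) (Fin N) ℝ} (hδ : 0 ≤ δ) (hwidth : ∀ l < L, (Φ.width l : ℝ) ≤ F)
    (hact : LipschitzWith 1 Φ.act) (hact0 : Φ.act 0 = 0)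
    (hbound : ∀ l < L, ∀ i j, ‖filterOp (Φ.taps l i j) S‖ ≤ 1 / F)
    (hpert : ∀ l < L, ∀ i j, ‖filterOp (Φ.taps l i j) S - filterOp (Φ.taps l i j) T‖ ≤ δ)
    (j : Fin (Φ.width L)) (q : Signal N) :
    ‖Φ.output L j S q - Φ.output L j T q‖ ≤ layerError F δ L * ‖q‖ := by
  induction L with
  | zero => simp [output_zero, layerError_zero]
  | succ L ih =>
    have hlt {l : ℕ} (hl : l < L) : l < L + 1 := hl.trans L.lt_succ_self
    have hF : 0 ≤ F := (Nat.cast_nonneg _).trans (hwidth L L.lt_succ_self)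
    have hd := layerError_nonneg hF hδ L
    set d := layerError F δ L
    have hprev : ∀ i, ‖Φ.output L i S q - Φ.output L i T q‖ ≤ d * ‖q‖ :=
      ih (fun l hl => hwidth l (hlt hl)) (fun l hl => hbound l (hlt hl))
        fun l hl => hpert l (hlt hl)
    have hsum : ∑ i, ‖Φ.output L i S q‖ ≤ ‖q‖ :=
      sum_norm_output_le (fun l hl => hwidth (l + 1) (Nat.succ_lt_succ hl)) hact hact0
        (fun l hl => hbound l (hlt hl)) q
    calc ‖Φ.output (L + 1) j S q - Φ.output (L + 1) j T q‖
      _ ≤ ‖∑ i, filterOp (Φ.taps L i j) S (Φ.output L i S q) -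
            ∑ i, filterOp (Φ.taps L i j) T (Φ.output L i T q)‖ := by
          simpa [output_succ] using (lipschitzWith_pointwise (ι := Fin N) hact).norm_sub_le _ _
      _ ≤ Φ.width L * ((1 / F + δ) * (d * ‖q‖)) + δ * ∑ i, ‖Φ.output L i S q‖ := by
          simpa using norm_sum_apply_sub_sum_apply_le (hbound L L.lt_succ_self · j)
            (hpert L L.lt_succ_self · j) hprev
      _ ≤ F * ((1 / F + δ) * (d * ‖q‖)) + δ * ‖q‖ := by
          gcongr
          exact hwidth L L.lt_succ_self
      _ = (F / F + F * δ) * d * ‖q‖ + δ * ‖q‖ := by ring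
      _ ≤ (1 + F * δ) * d * ‖q‖ + δ * ‖q‖ := by
          gcongr
          exact div_self_le_one F
      _ = layerError F δ (L + 1) * ‖q‖ := by
          rw [layerError_succ]
          ring

end Stability

section Encodings

variable {N K L M : ℕ} {Φ : GNN K} {f : Fin (Φ.width L)} {S T : Matrix (Fin N) (Fin N) ℝ} {β : ℝ}

theorem norm_one_div_smul_sum_le {E : Type*} [SeminormedAddCommGroup E] [NormedSpace ℝ E]
    (hβ : 0 ≤ β) {x : Fin M → E} (hx : ∀ m, ‖x m‖ ≤ β) : ‖(1 / (M : ℝ)) • ∑ m, x m‖ ≤ β := by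
  calc ‖(1 / (M : ℝ)) • ∑ m, x m‖ = 1 / M * ‖∑ m, x m‖ := by
        rw [norm_smul, Real.norm_of_nonneg (by positivity)]
    _ ≤ 1 / M * (M * β) := by
        gcongr
        simpa using norm_sum_le_of_le Finset.univ fun m _ => hx m
    _ = (M / M : ℝ) * β := by ring
    _ ≤ β := mul_le_of_le_one_left hβ (div_self_le_one _)

theorem norm_rPearl_sub_rPearl_le (hβ : 0 ≤ β) {q : Fin M → Signal N}
    (h : ∀ m, ‖Φ.output L f S (q m) - Φ.output L f T (q m)‖ ≤ β) :
    ‖rPearl Φ L f S q - rPearl Φ L f T q‖ ≤ β := by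
  rw [rPearl, rPearl, ← smul_sub, ← Finset.sum_sub_distrib]
  exact norm_one_div_smul_sum_le hβ h

theorem one_div_smul_bPearl :
    (1 / (N : ℝ)) • bPearl Φ L f S = rPearl Φ L f S fun m => EuclideanSpace.single m 1 := rfl

theorem enorm_le_ofReal {E : Type*} [SeminormedAddGroup E] {x : E} (h : ‖x‖ ≤ β) :
    ‖x‖ₑ ≤ ENNReal.ofReal β := by
  rw [← ofReal_norm]
  exact ENNReal.ofReal_le_ofReal h

theorem signalDist_le_ofReal {a b : Signal N} (h : ‖a - b‖ ≤ β) :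
    signalDist a b ≤ ENNReal.ofReal β :=
  iInf_le_of_le 1 (enorm_le_ofReal h)

theorem opDistMulti_le_ofReal {A B : (Fin M → Signal N) → Signal N}
    (h : ∀ q, (∀ m, ‖q m‖ = 1) → ‖A q - B q‖ ≤ β) : opDistMulti A B ≤ ENNReal.ofReal β :=
  iInf_le_of_le 1 <| iSup₂_le fun q hq => enorm_le_ofReal (h q hq)

theorem opDist_le_ofReal {A B : Signal N → Signal N}
    (h : ∀ x, ‖x‖ = 1 → ‖A x - B x‖ ≤ β) : opDist A B ≤ ENNReal.ofReal β :=
  iInf_le_of_le 1 <| iSup₂_le fun x hx => enorm_le_ofReal (h x hx)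

end Encodings

end Pearl

/-- The remainder `r` depends on `N`, `F`, `L`, `C` only, so the bound is uniform in the shift
operator (in particular in its eigengaps), the perturbation, the network and the number of
samples.  The last alternative in `_hI` covers filters that are Lipschitz just on a set containing
the spectra of two symmetric shift operators; for `I = Set.univ` no symmetry is needed. -/
theorem mainTheorem3 (N F L : ℕ) (hF : 0 < F) (C : ℝ) (hC : 0 ≤ C) :
    ∃ r : ℝ → ℝ, Asymptotics.IsBigO (nhds 0) r (fun ε : ℝ => ε ^ 2) ∧
      ∀ (K : ℕ) (Φ : Pearl.GNN K) (S E : Matrix (Fin N) (Fin N) ℝ) (ε : ℝ) (I : Set ℝ)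
        (_hwidth : ∀ l, 0 < l → l < L → Φ.width l ≤ F)
        (_hact : LipschitzWith 1 Φ.act) (_hact0 : Φ.act 0 = 0)
        (_hE : Pearl.opNorm E ≤ ε)
        (_hI : I = Set.univ ∨
          (S.IsSymm ∧ E.IsSymm ∧ spectrum ℝ S ⊆ I ∧ spectrum ℝ (S + E) ⊆ I))
        (_hLip : ∀ l, l < L → ∀ i j, Pearl.IsLipschitzFilterOn C I (Φ.taps l i j))
        (_hbound : ∀ l, l < L → ∀ i j,
          Pearl.opNorm (Pearl.graphFilter (Φ.taps l i j) S) ≤ 1 / (F : ℝ))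
        (f : Fin (Φ.width L)),
        (∀ M : ℕ,
          Pearl.opDistMulti (M := M) (Pearl.rPearl Φ L f S) (Pearl.rPearl Φ L f (S + E)) ≤
              ENNReal.ofReal (C * (1 + 8 * Real.sqrt N) * L * ε + r ε) ∧
          Pearl.opDist (fun x => Pearl.rPearl Φ L f S (fun _ : Fin M => x))
              (fun x => Pearl.rPearl Φ L f (S + E) (fun _ : Fin M => x)) ≤
              ENNReal.ofReal (C * (1 + 8 * Real.sqrt N) * L * ε + r ε)) ∧
        Pearl.signalDist ((1 / (N : ℝ)) • Pearl.bPearl Φ L f S)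
            ((1 / (N : ℝ)) • Pearl.bPearl Φ L f (S + E)) ≤
          ENNReal.ofReal (C * (1 + 8 * Real.sqrt N) * L * ε + r ε) := by
  set c : ℝ := C * (1 + 8 * √N)
  have hc : 0 ≤ c := by positivity
  refine ⟨fun ε => Pearl.layerError F (c * ε) L - c * L * ε,
    Pearl.isBigO_layerError_sub_linear F c L, ?_⟩
  intro K Φ S E ε I hwidth hact hact0 hE hI hLip hbound f
  have hcε : 0 ≤ c * ε := mul_nonneg hc ((norm_nonneg _).trans hE)
  have houtput : ∀ q : Pearl.Signal N, ‖q‖ = 1 →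
      ‖Φ.output L f S q - Φ.output L f (S + E) q‖ ≤ Pearl.layerError F (c * ε) L := by
    intro q hq
    simpa only [hq, mul_one] using Pearl.norm_output_sub_output_le hcε
      (Pearl.width_le_of_forall_pos hF hwidth) hact hact0 hbound
      (fun l hl i j => Pearl.norm_filterOp_sub_filterOp_add_le_of_opNorm_le hC hI
        (hLip l hl i j) hE) f q
  have herror := Pearl.layerError_nonneg F.cast_nonneg hcε L
  simp only [add_sub_cancel, Pearl.one_div_smul_bPearl]
  refine ⟨fun M => ⟨Pearl.opDistMulti_le_ofReal fun q hq => ?_,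
    Pearl.opDist_le_ofReal fun x hx => ?_⟩, Pearl.signalDist_le_ofReal ?_⟩
  · exact Pearl.norm_rPearl_sub_rPearl_le herror fun m => houtput _ (hq m)
  · exact Pearl.norm_rPearl_sub_rPearl_le herror fun _ => houtput _ hx
  · exact Pearl.norm_rPearl_sub_rPearl_le herror fun m => houtput _ (by simp)
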